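/- Let $\mu$ be a positive Borel measure on $\mathbb{R}$ whose support is not a finite set and all of whose moments are finite, $\int |x|^n\,d\mu(x)<\infty$ for $n=0,1,2,\dots$. Let $p_n$ $(n\ge 0)$ be its orthonormal polynomials, that is, $\deg p_n=n$, the leading coefficient of $p_n$ is positive, and $\int p_n p_m\,d\mu=\delta_{nm}$; let $a_n>0$, $b_n\in\mathbb{R}$ $(n\ge 1)$ be the recursion coefficients determined by $x p_n(x)=a_{n+1}p_{n+1}(x)+b_{n+1}p_n(x)+a_n p_{n-1}(x)$ (where the last term is absent for $n=0$). For $x_0\in\mathbb{R}$ and $\delta>0$ let $N_n(x_0,\delta)$ be the number of zeros of $p_n$ in $(x_0-\delta,x_0+\delta)$. **Theorem 2.** Let $x_0$ be an isolated point of $\operatorname{supp}\mu$. Then there exists $d_0>0$ such that the following hold. 1. For every $n\ge 0$, with $\delta_n=d_0^2/(d_0+\sqrt2\,a_{n+1})$, at least one of $p_n$ and $p_{n+1}$ has at most one zero in $(x_0-\delta_n,x_0+\delta_n)$. 2. If $a_\infty=\sup_{n\ge 1}a_n<\infty$ and $\delta_\infty=d_0^2/(d_0+\sqrt2\,a_\infty)$,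 then for all large $n$, either $N_n(x_0,\delta_\infty)=1$ or $N_{n+1}(x_0,\delta_\infty)=1$ (or both). -/

import Mathlib

open MeasureTheory Polynomial

noncomputable section

namespace OPRL

/-- The standing assumption on the (positive Borel) measure `μ` on the line: its support is not a
finite set, and all its moments are finite. -/
structure IsNontrivial (μ : Measure ℝ) : Prop where
  infinite_support : μ.support.Infinite
  moments : ∀ n : ℕ, Integrable (fun x : ℝ => |x| ^ n) μ

/-- The pairing `∫ f g dμ` of two real polynomials. -/
def pairing (μ : Measure ℝ) (f g : ℝ[X]) : ℝ := ∫ x, f.eval x * g.eval x ∂μ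

/-- `p` is the sequence of orthonormal polynomials of `μ`: `p n` has degree exactly `n` and positive
leading coefficient, and `∫ p n * p m dμ = δ_{nm}`. See `orthonormalPoly_spec` and
`IsOrthonormalSeq.unique` for existence and uniqueness. -/
structure IsOrthonormalSeq (μ : Measure ℝ) (p : ℕ → ℝ[X]) : Prop where
  natDegree : ∀ n, (p n).natDegree = n
  leadingCoeff_pos : ∀ n, 0 < (p n).leadingCoeff
  orthonormal : ∀ n m, ∫ x, (p n).eval x * (p m).eval x ∂μ = if n = m then 1 else 0

/-- The monic orthogonal polynomials of `μ`, by the Gram–Schmidt process applied to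
`1, x, x², …`. -/
def monicPoly (μ : Measure ℝ) (n : ℕ) : ℝ[X] :=
  X ^ n - ∑ k : Fin n,
    C (pairing μ (X ^ n) (monicPoly μ k) / pairing μ (monicPoly μ k) (monicPoly μ k)) *
      monicPoly μ k
termination_by n
decreasing_by all_goals exact k.isLt

/-- The orthonormal polynomial `p_n(x; dμ)`. -/
def orthonormalPoly (μ : Measure ℝ) (n : ℕ) : ℝ[X] :=
  C (Real.sqrt (pairing μ (monicPoly μ n) (monicPoly μ n)))⁻¹ * monicPoly μ n

/-- The recursion coefficient `a_n`, `n ≥ 1` (the value at `n = 0` is not used); see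
`recursion_zero`, `recursion_succ` and `recA_pos`. -/
def recA (μ : Measure ℝ) (n : ℕ) : ℝ :=
  ∫ x, x * (orthonormalPoly μ (n - 1)).eval x * (orthonormalPoly μ n).eval x ∂μ

/-- The recursion coefficient `b_n`, `n ≥ 1` (the value at `n = 0` is not used). -/
def recB (μ : Measure ℝ) (n : ℕ) : ℝ :=
  ∫ x, x * (orthonormalPoly μ (n - 1)).eval x * (orthonormalPoly μ (n - 1)).eval x ∂μ

/-- `N_n(x₀, δ)`: the number of zeros of `p_n` in the open interval `(x₀ - δ, x₀ + δ)`. -/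
def zeroCount (μ : Measure ℝ) (n : ℕ) (x₀ δ : ℝ) : ℕ∞ :=
  {x : ℝ | x ∈ Set.Ioo (x₀ - δ) (x₀ + δ) ∧ (orthonormalPoly μ n).eval x = 0}.encard

/-- `x₀` is an isolated point of the set `S`. -/
def IsIsolatedPoint (S : Set ℝ) (x₀ : ℝ) : Prop :=
  ∃ ε > 0, S ∩ Set.Ioo (x₀ - ε) (x₀ + ε) = {x₀}

/-! ### The objects defined above have their defining properties -/

theorem IsNontrivial.integrable_eval {μ : Measure ℝ} (h : IsNontrivial μ) (f : ℝ[X]) :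
    Integrable (fun x => f.eval x) μ := by
  induction f using Polynomial.induction_on' with
  | add p q hp hq =>
    simp only [eval_add]
    exact hp.add hq
  | monomial n a =>
    simp only [eval_monomial]
    refine Integrable.const_mul ?_ a
    refine (h.moments n).mono' (by fun_prop) (ae_of_all _ fun x => ?_)
    simp

theorem IsNontrivial.integrable_mul {μ : Measure ℝ} (h : IsNontrivial μ) (f g : ℝ[X]) :
    Integrable (fun x => f.eval x * g.eval x) μ := by
  simpa using h.integrable_eval (f * g)

theorem pairing_comm (μ : Measure ℝ) (f g : ℝ[X]) : pairing μ f g = pairing μ g f := by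
  simp [pairing, mul_comm]

theorem pairing_C_mul (μ : Measure ℝ) (c : ℝ) (f g : ℝ[X]) :
    pairing μ (C c * f) g = c * pairing μ f g := by
  simp [pairing, mul_assoc, integral_const_mul]

theorem pairing_C_mul_right (μ : Measure ℝ) (c : ℝ) (f g : ℝ[X]) :
    pairing μ f (C c * g) = c * pairing μ f g := by
  rw [pairing_comm, pairing_C_mul, pairing_comm]

theorem IsNontrivial.pairing_sub {μ : Measure ℝ} (h : IsNontrivial μ) (f₁ f₂ g : ℝ[X]) :
    pairing μ (f₁ - f₂) g = pairing μ f₁ g - pairing μ f₂ g := by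
  simp only [pairing, eval_sub, sub_mul]
  exact integral_sub (h.integrable_mul _ _) (h.integrable_mul _ _)

theorem IsNontrivial.pairing_sum {μ : Measure ℝ} (h : IsNontrivial μ) {ι : Type*} (s : Finset ι)
    (f : ι → ℝ[X]) (g : ℝ[X]) :
    pairing μ (∑ k ∈ s, f k) g = ∑ k ∈ s, pairing μ (f k) g := by
  simp only [pairing, eval_finsetSum, Finset.sum_mul]
  exact integral_finsetSum _ fun k _ => h.integrable_mul _ _

theorem IsNontrivial.pairing_self_pos {μ : Measure ℝ} (h : IsNontrivial μ) {f : ℝ[X]}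
    (hf : f ≠ 0) : 0 < pairing μ f f := by
  have h0 : 0 ≤ pairing μ f f := integral_nonneg fun x => mul_self_nonneg _
  refine lt_of_le_of_ne h0 fun he => ?_
  have h1 : (fun x => f.eval x * f.eval x) =ᵐ[μ] 0 :=
    (integral_eq_zero_iff_of_nonneg (fun x => mul_self_nonneg _) (h.integrable_mul f f)).1 he.symm
  have h2 : μ.support ⊆ {x | f.IsRoot x} := by
    refine Measure.support_subset_of_isClosed (isClosed_eq f.continuous continuous_const) ?_
    filter_upwards [h1] with x hx
    exact mul_self_eq_zero.1 hx
  exact h.infinite_support ((Polynomial.finite_setOfPred_isRoot hf).subset h2)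

theorem monicPoly_eq (μ : Measure ℝ) (n : ℕ) :
    monicPoly μ n = X ^ n - ∑ k ∈ Finset.range n,
      C (pairing μ (X ^ n) (monicPoly μ k) / pairing μ (monicPoly μ k) (monicPoly μ k)) *
        monicPoly μ k := by
  rw [monicPoly, Finset.sum_range]

theorem monicPoly_monic_natDegree (μ : Measure ℝ) (n : ℕ) :
    (monicPoly μ n).Monic ∧ (monicPoly μ n).natDegree = n := by
  induction n using Nat.strong_induction_on with
  | _ n ih =>
    have hd : (∑ k ∈ Finset.range n,
        C (pairing μ (X ^ n) (monicPoly μ k) / pairing μ (monicPoly μ k) (monicPoly μ k)) *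
          monicPoly μ k).degree < (n : WithBot ℕ) := by
      rw [← Polynomial.mem_degreeLT]
      refine Submodule.sum_mem _ fun k hk => ?_
      rw [← Polynomial.smul_eq_C_mul]
      refine Submodule.smul_mem _ _ ?_
      have hk' := Finset.mem_range.1 hk
      rw [Polynomial.mem_degreeLT, degree_eq_natDegree (ih k hk').1.ne_zero, (ih k hk').2]
      exact_mod_cast hk'
    rw [monicPoly_eq]
    have hm := monic_X_pow_sub hd
    refine ⟨hm, ?_⟩
    have : (X ^ n - _ : ℝ[X]).degree = (X ^ n : ℝ[X]).degree :=
      degree_sub_eq_left_of_degree_lt (by simpa using hd)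
    rw [natDegree_eq_of_degree_eq this, natDegree_X_pow]

theorem IsNontrivial.monicPoly_orthogonal {μ : Measure ℝ} (h : IsNontrivial μ) (n : ℕ) :
    ∀ m < n, pairing μ (monicPoly μ n) (monicPoly μ m) = 0 := by
  induction n using Nat.strong_induction_on with
  | _ n ih =>
    intro m hm
    have hpos := h.pairing_self_pos (monicPoly_monic_natDegree μ m).1.ne_zero
    rw [monicPoly_eq μ n, h.pairing_sub, h.pairing_sum, Finset.sum_eq_single m]
    · rw [pairing_C_mul, div_mul_cancel₀ _ hpos.ne', sub_self]
    · intro k hk hkm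
      rw [pairing_C_mul]
      rcases lt_or_gt_of_ne hkm with hlt | hlt
      · rw [pairing_comm μ (monicPoly μ k) (monicPoly μ m), ih m hm k hlt, mul_zero]
      · rw [ih k (Finset.mem_range.1 hk) m hlt, mul_zero]
    · intro hk
      exact absurd (Finset.mem_range.2 hm) hk

/-- The polynomials `orthonormalPoly μ n` are the orthonormal polynomials of `μ`. -/
theorem orthonormalPoly_spec {μ : Measure ℝ} (h : IsNontrivial μ) :
    IsOrthonormalSeq μ (orthonormalPoly μ) := by
  have hpos : ∀ n, 0 < (Real.sqrt (pairing μ (monicPoly μ n) (monicPoly μ n)))⁻¹ := fun n =>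
    inv_pos.2 (Real.sqrt_pos.2 (h.pairing_self_pos (monicPoly_monic_natDegree μ n).1.ne_zero))
  refine ⟨fun n => ?_, fun n => ?_, fun n m => ?_⟩
  · rw [orthonormalPoly, natDegree_C_mul (hpos n).ne', (monicPoly_monic_natDegree μ n).2]
  · rw [orthonormalPoly, leadingCoeff_mul, leadingCoeff_C,
      (monicPoly_monic_natDegree μ n).1.leadingCoeff, mul_one]
    exact hpos n
  · change pairing μ _ _ = _
    rw [orthonormalPoly, orthonormalPoly, pairing_C_mul, pairing_C_mul_right]
    split_ifs with hnm
    · subst hnm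
      have h1 := h.pairing_self_pos (monicPoly_monic_natDegree μ n).1.ne_zero
      have h2 := Real.mul_self_sqrt h1.le
      have h3 := Real.sqrt_pos.2 h1
      field_simp
      nlinarith
    · rcases lt_or_gt_of_ne hnm with hlt | hlt
      · rw [pairing_comm μ (monicPoly μ n) (monicPoly μ m), h.monicPoly_orthogonal m n hlt]; simp
      · rw [h.monicPoly_orthogonal n m hlt]; simp

theorem IsOrthonormalSeq.expand {μ : Measure ℝ} (h : IsNontrivial μ) {p : ℕ → ℝ[X]}
    (hp : IsOrthonormalSeq μ p) (N : ℕ) (f : ℝ[X]) (hf : f.degree < N) :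
    f = ∑ k ∈ Finset.range N, C (pairing μ f (p k)) * p k := by
  have key : ∀ (N : ℕ) (f : ℝ[X]), f.degree < N →
      ∃ c : ℕ → ℝ, f = ∑ k ∈ Finset.range N, C (c k) * p k := by
    intro N
    induction N with
    | zero =>
      intro f hf
      exact ⟨0, by simpa [Nat.cast_zero, Nat.WithBot.lt_zero_iff] using hf⟩
    | succ N ih =>
      intro f hf
      have hpN := (hp.leadingCoeff_pos N).ne'
      have hc : (p N).coeff N ≠ 0 := by
        have := hp.natDegree N
        rwa [leadingCoeff, this] at hpN
      obtain ⟨c, hcf⟩ := ih (f - C (f.coeff N / (p N).coeff N) * p N) (by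
        rw [degree_lt_iff_coeff_zero]
        intro m hm
        rw [coeff_sub, coeff_C_mul]
        rcases hm.eq_or_lt with rfl | hlt
        · field_simp; simp
        · rw [coeff_eq_zero_of_natDegree_lt (lt_of_eq_of_lt (hp.natDegree N) hlt),
            (degree_lt_iff_coeff_zero _ _).1 hf m hlt]
          simp)
      refine ⟨fun k => if k = N then f.coeff N / (p N).coeff N else c k, ?_⟩
      rw [Finset.sum_range_succ]
      simp only [if_true]
      rw [← sub_eq_iff_eq_add, hcf]
      refine Finset.sum_congr rfl fun k hk => ?_
      rw [if_neg (Finset.mem_range.1 hk).ne]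
  obtain ⟨c, hc⟩ := key N f hf
  have : ∀ k ∈ Finset.range N, pairing μ f (p k) = c k := by
    intro k hk
    rw [hc, h.pairing_sum, Finset.sum_eq_single k]
    · rw [pairing_C_mul, pairing, hp.orthonormal, if_pos rfl, mul_one]
    · intro j _ hj
      rw [pairing_C_mul, pairing, hp.orthonormal, if_neg hj, mul_zero]
    · intro hk'
      exact absurd hk hk'
  rw [Finset.sum_congr rfl fun k hk => by rw [this k hk]]
  exact hc

theorem IsOrthonormalSeq.degree {μ : Measure ℝ} {p : ℕ → ℝ[X]}
    (hp : IsOrthonormalSeq μ p) (n : ℕ) : (p n).degree = n := by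
  rw [degree_eq_natDegree (leadingCoeff_ne_zero.1 (hp.leadingCoeff_pos n).ne'), hp.natDegree]

theorem IsOrthonormalSeq.pairing_eq_zero {μ : Measure ℝ} (h : IsNontrivial μ) {p : ℕ → ℝ[X]}
    (hp : IsOrthonormalSeq μ p) {n : ℕ} {f : ℝ[X]} (hf : f.degree < n) :
    pairing μ f (p n) = 0 := by
  rw [hp.expand h n f hf, h.pairing_sum]
  refine Finset.sum_eq_zero fun k hk => ?_
  rw [pairing_C_mul, pairing.eq_def μ (p k), hp.orthonormal, if_neg (Finset.mem_range.1 hk).ne,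
    mul_zero]

/-- The orthonormal polynomials of `μ` are unique. -/
theorem IsOrthonormalSeq.unique {μ : Measure ℝ} (h : IsNontrivial μ) {p q : ℕ → ℝ[X]}
    (hp : IsOrthonormalSeq μ p) (hq : IsOrthonormalSeq μ q) : p = q := by
  funext n
  have h1 : p n = C (pairing μ (p n) (q n)) * q n := by
    conv_lhs => rw [hq.expand h (n + 1) (p n) (by rw [hp.degree]; exact_mod_cast n.lt_succ_self)]
    rw [Finset.sum_range_succ, Finset.sum_eq_zero, zero_add]
    intro k hk
    rw [pairing_comm, hp.pairing_eq_zero h (by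
      rw [hq.degree]; exact_mod_cast Finset.mem_range.1 hk), C_0, zero_mul]
  set c := pairing μ (p n) (q n) with hc
  have h2 : c * c = 1 := by
    have h3 := hp.orthonormal n n
    change pairing μ _ _ = _ at h3
    rw [h1, pairing_C_mul, pairing_comm, pairing_C_mul, pairing, hq.orthonormal] at h3
    simpa using h3
  have h4 : 0 < c := by
    have h5 := hp.leadingCoeff_pos n
    rw [h1, leadingCoeff_mul, leadingCoeff_C] at h5
    exact (mul_pos_iff_of_pos_right (hq.leadingCoeff_pos n)).1 h5
  have h6 : c = 1 := by nlinarith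
  rw [h1, h6, C_1, one_mul]

theorem pairing_X_mul (μ : Measure ℝ) (f g : ℝ[X]) :
    pairing μ (X * f) g = ∫ x, x * f.eval x * g.eval x ∂μ := by
  simp [pairing]

theorem pairing_X_mul_comm (μ : Measure ℝ) (f g : ℝ[X]) :
    pairing μ (X * f) g = pairing μ (X * g) f := by
  simp only [pairing_X_mul]
  congr 1
  funext x
  ring

theorem degree_X_mul_orthonormalPoly {μ : Measure ℝ} (h : IsNontrivial μ) (n : ℕ) :
    (X * orthonormalPoly μ n).degree = ((n + 1 : ℕ) : WithBot ℕ) := by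
  rw [degree_mul, degree_X, (orthonormalPoly_spec h).degree]
  push_cast
  exact add_comm _ _

/-- `x p_0 = a_1 p_1 + b_1 p_0`. -/
theorem recursion_zero {μ : Measure ℝ} (h : IsNontrivial μ) :
    X * orthonormalPoly μ 0 =
      C (recA μ 1) * orthonormalPoly μ 1 + C (recB μ 1) * orthonormalPoly μ 0 := by
  have hp := orthonormalPoly_spec h
  conv_lhs => rw [hp.expand h 2 (X * orthonormalPoly μ 0) (by
    rw [degree_X_mul_orthonormalPoly h]; norm_num)]
  rw [Finset.sum_range_succ, Finset.sum_range_one, pairing_X_mul, pairing_X_mul, recA, recB,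
    add_comm]

/-- `x p_n = a_{n+1} p_{n+1} + b_{n+1} p_n + a_n p_{n-1}` for `n ≥ 1`. -/
theorem recursion_succ {μ : Measure ℝ} (h : IsNontrivial μ) (n : ℕ) :
    X * orthonormalPoly μ (n + 1) =
      C (recA μ (n + 2)) * orthonormalPoly μ (n + 2) +
      C (recB μ (n + 2)) * orthonormalPoly μ (n + 1) +
      C (recA μ (n + 1)) * orthonormalPoly μ n := by
  have hp := orthonormalPoly_spec h
  conv_lhs => rw [hp.expand h (n + 3) (X * orthonormalPoly μ (n + 1)) (by
    rw [degree_X_mul_orthonormalPoly h]; exact_mod_cast Nat.lt_succ_self _)]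
  rw [Finset.sum_range_succ, Finset.sum_range_succ, Finset.sum_range_succ, Finset.sum_eq_zero]
  · rw [pairing_X_mul_comm μ _ (orthonormalPoly μ n)]
    simp only [pairing_X_mul, recA, recB, Nat.add_sub_cancel,
      show n + 2 - 1 = n + 1 from rfl]
    ring
  · intro k hk
    have hk' := Finset.mem_range.1 hk
    rw [pairing_X_mul_comm, hp.pairing_eq_zero h, C_0, zero_mul]
    rw [degree_X_mul_orthonormalPoly h]
    exact_mod_cast Nat.succ_lt_succ hk'

/-- `a_n > 0` for `n ≥ 1`. -/
theorem recA_pos {μ : Measure ℝ} (h : IsNontrivial μ) (n : ℕ) : 0 < recA μ (n + 1) := by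
  have hp := orthonormalPoly_spec h
  have hlt : ∀ k m : ℕ, k < m → (orthonormalPoly μ k).coeff m = 0 := fun k m hkm =>
    coeff_eq_zero_of_natDegree_lt (by rwa [hp.natDegree])
  have hlc : ∀ m, 0 < (orthonormalPoly μ m).coeff m := fun m => by
    have := hp.leadingCoeff_pos m
    rwa [leadingCoeff, hp.natDegree] at this
  have key : (orthonormalPoly μ n).coeff n =
      recA μ (n + 1) * (orthonormalPoly μ (n + 1)).coeff (n + 1) := by
    rw [← coeff_X_mul]
    cases n with
    | zero =>
      rw [recursion_zero h]
      simp [hlt 0 1 one_pos]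
    | succ n =>
      rw [recursion_succ h]
      simp [hlt (n + 1) (n + 2) (by lia), hlt n (n + 2) (by lia)]
  have h1 := hlc n
  rw [key] at h1
  exact (mul_pos_iff_of_pos_right (hlc (n + 1))).1 h1

end OPRL

end

/-! An isolated point `x₀` of the support carries an atom. On the orthogonal complement of the
constants the compression of multiplication by `x - x₀` is bounded below by some `d > 0`
(`IsNontrivial.exists_gap`): orthogonality to `1` controls the value at the atom by the values away
from it, where `|x - x₀|` is bounded below. This `d` serves as `d₀`.

Let `r` be the second kind solution at `x₀` and `w = ∑ r_k p_k`, summed over `k ≤ n`. Since `r_0 =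
0`, `w` is orthogonal to constants, and up to a constant `(x - x₀) w` is `a_{n+1} (r_n p_{n+1} -
r_{n+1} p_n)`. The gap thus bounds `r_n² + r_{n+1}²` below by `d² ‖w‖² / a_{n+1}²`. On the other
hand, two zeros of `p_n` within `δ < d` of `x₀` make `r_n` small (`IsNontrivial.secondKind_sq_le`):
the difference of the two Christoffel–Darboux kernels is orthogonal to constants and is nearly
annihilated by `x - x₀` apart from a multiple of `p_n`; pairing it with `w` isolates `r_n`. If both
`p_n` and `p_{n+1}` had two zeros, then `d (d - δ) ≤ √2 a_{n+1} δ`, which fails for `δ < δ_n`.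

For existence of zeros, the atom makes `∑ p_k(x₀)²` converge. The vector of the `p_k(x₀)` is then an
approximate eigenvector of the truncated Jacobi matrix, whose eigenvalues are zeros of `p_n`; with
bounded `a_n` the error tends to `0`. -/

/-- A self-adjoint operator on a finite-dimensional space has an eigenvalue within
`‖T u - x u‖ / ‖u‖` of `x`. -/
theorem LinearMap.IsSymmetric.exists_eigenvalue_sq_mul_le {E : Type*} [NormedAddCommGroup E]
    [InnerProductSpace ℝ E] [FiniteDimensional ℝ E] {T : E →ₗ[ℝ] E} (hT : T.IsSymmetric)
    (x : ℝ) {u : E} (hu : u ≠ 0) :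
    ∃ l, Module.End.HasEigenvalue T l ∧ (l - x) ^ 2 * ‖u‖ ^ 2 ≤ ‖T u - x • u‖ ^ 2 := by
  by_contra! hcon
  set b := hT.eigenvectorBasis rfl
  have h1 : ∀ v : E, ‖v‖ ^ 2 = ∑ i, (b.repr v i) ^ 2 := fun v => by
    rw [← b.repr.norm_map v, EuclideanSpace.norm_sq_eq]
    simp
  have h2 : ∀ i, b.repr (T u - x • u) i = (hT.eigenvalues rfl i - x) * b.repr u i := fun i => by
    rw [map_sub, map_smul, PiLp.sub_apply, PiLp.smul_apply,
      hT.eigenvectorBasis_apply_self_apply rfl u i]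
    simp [b, sub_mul]
  have h5 : ∀ i, ‖T u - x • u‖ ^ 2 < (hT.eigenvalues rfl i - x) ^ 2 * ‖u‖ ^ 2 := fun i =>
    hcon _ (hT.hasEigenvalue_eigenvalues rfl i)
  have hupos : 0 < ‖u‖ ^ 2 := by positivity
  obtain ⟨i, -, hi⟩ : ∃ i ∈ Finset.univ, b.repr u i ^ 2 ≠ 0 :=
    Finset.exists_ne_zero_of_sum_ne_zero ((h1 u).symm.trans_ne hupos.ne')
  -- Weighting the strict inequalities `h5` by the squared coordinates of `u` and summing gives `‖T
  -- u - x u‖² ‖u‖²` on both sides, which is absurd; one nonzero coordinate keeps the inequality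
  -- strict.
  have h3 : ∑ i, ‖T u - x • u‖ ^ 2 * b.repr u i ^ 2 <
      ∑ i, ‖u‖ ^ 2 * (b.repr (T u - x • u) i) ^ 2 := by
    refine Finset.sum_lt_sum (fun j _ => ?_) ⟨i, Finset.mem_univ i, ?_⟩
    · rw [h2]
      linarith [mul_le_mul_of_nonneg_right (h5 j).le (sq_nonneg (b.repr u j))]
    · rw [h2]
      have h4 : 0 < b.repr u i ^ 2 := lt_of_le_of_ne (sq_nonneg _) hi.symm
      linarith [mul_lt_mul_of_pos_right (h5 i) h4]
  rw [← Finset.mul_sum, ← Finset.mul_sum, ← h1, ← h1] at h3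
  linarith

namespace OPRL

/-! ### The pairing and orthonormal expansions -/

section Pairing

variable {μ : Measure ℝ}

theorem pairing_nonneg (μ : Measure ℝ) (f : ℝ[X]) : 0 ≤ pairing μ f f :=
  integral_nonneg fun _ => mul_self_nonneg _

theorem IsNontrivial.pairing_add (h : IsNontrivial μ) (f₁ f₂ g : ℝ[X]) :
    pairing μ (f₁ + f₂) g = pairing μ f₁ g + pairing μ f₂ g := by
  simp only [pairing, eval_add, add_mul]
  exact integral_add (h.integrable_mul _ _) (h.integrable_mul _ _)

theorem IsNontrivial.pairing_add_right (h : IsNontrivial μ) (f g₁ g₂ : ℝ[X]) :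
    pairing μ f (g₁ + g₂) = pairing μ f g₁ + pairing μ f g₂ := by
  simp only [pairing_comm μ f, h.pairing_add]

theorem IsNontrivial.pairing_sub_right (h : IsNontrivial μ) (f g₁ g₂ : ℝ[X]) :
    pairing μ f (g₁ - g₂) = pairing μ f g₁ - pairing μ f g₂ := by
  simp only [pairing_comm μ f, h.pairing_sub]

theorem pairing_mul_comm (μ : Measure ℝ) (k f g : ℝ[X]) :
    pairing μ (k * f) g = pairing μ f (k * g) := by
  simp only [pairing, eval_mul]
  congr 1
  funext x
  ring

/-- The Cauchy–Schwarz inequality. -/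
theorem IsNontrivial.pairing_sq_le (h : IsNontrivial μ) (f g : ℝ[X]) :
    pairing μ f g ^ 2 ≤ pairing μ f f * pairing μ g g := by
  by_cases hg : g = 0
  · simp [hg, pairing]
  have hpos := h.pairing_self_pos hg
  have key := pairing_nonneg μ (C (pairing μ g g) * f - C (pairing μ f g) * g)
  simp only [h.pairing_sub, h.pairing_sub_right, pairing_C_mul, pairing_C_mul_right,
    pairing_comm μ g f] at key
  have : 0 ≤ pairing μ g g * (pairing μ f f * pairing μ g g - pairing μ f g ^ 2) := by
    linarith
  exact sub_nonneg.1 (nonneg_of_mul_nonneg_right this hpos)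

theorem IsNontrivial.pairing_orthonormalPoly (h : IsNontrivial μ) (m n : ℕ) :
    pairing μ (orthonormalPoly μ m) (orthonormalPoly μ n) = if m = n then 1 else 0 :=
  (orthonormalPoly_spec h).orthonormal m n

/-- The polynomial `∑_{k < n} c_k p_k`. -/
noncomputable def orthoSum (μ : Measure ℝ) (n : ℕ) (c : ℕ → ℝ) : ℝ[X] :=
  ∑ k ∈ Finset.range n, C (c k) * orthonormalPoly μ k

theorem orthoSum_succ (μ : Measure ℝ) (n : ℕ) (c : ℕ → ℝ) :
    orthoSum μ (n + 1) c = orthoSum μ n c + C (c n) * orthonormalPoly μ n :=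
  Finset.sum_range_succ _ _

theorem IsNontrivial.pairing_orthoSum_orthonormalPoly (h : IsNontrivial μ) (n : ℕ) (c : ℕ → ℝ)
    (j : ℕ) : pairing μ (orthoSum μ n c) (orthonormalPoly μ j) = if j < n then c j else 0 := by
  simp [orthoSum, h.pairing_sum, pairing_C_mul, h.pairing_orthonormalPoly]

theorem IsNontrivial.pairing_orthoSum (h : IsNontrivial μ) (n : ℕ) (c d : ℕ → ℝ) :
    pairing μ (orthoSum μ n c) (orthoSum μ n d) = ∑ k ∈ Finset.range n, c k * d k := by
  rw [orthoSum, h.pairing_sum]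
  refine Finset.sum_congr rfl fun k hk => ?_
  rw [pairing_C_mul, pairing_comm, h.pairing_orthoSum_orthonormalPoly,
    if_pos (Finset.mem_range.1 hk)]

theorem orthonormalPoly_zero_eq_C (h : IsNontrivial μ) :
    ∃ c : ℝ, 0 < c ∧ orthonormalPoly μ 0 = C c := by
  have hp := orthonormalPoly_spec h
  have h1 := eq_C_of_natDegree_eq_zero (hp.natDegree 0)
  refine ⟨_, ?_, h1⟩
  have h2 := hp.leadingCoeff_pos 0
  rwa [leadingCoeff, hp.natDegree] at h2

end Pairing

/-! ### Solutions of the three-term recursion -/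

section Recursion

variable {μ : Measure ℝ}

/-- A sequence solving the three-term recursion at `z`, with an arbitrary first step, gives a
solution of the eigenvalue equation up to boundary terms. -/
theorem sub_mul_orthoSum (h : IsNontrivial μ) (z e : ℝ) (u : ℕ → ℝ)
    (h0 : z * u 0 = recA μ 1 * u 1 + recB μ 1 * u 0 - e)
    (hu : ∀ n, z * u (n + 1) =
      recA μ (n + 2) * u (n + 2) + recB μ (n + 2) * u (n + 1) + recA μ (n + 1) * u n) (n : ℕ) :
    (X - C z) * orthoSum μ (n + 1) u = C e * orthonormalPoly μ 0 +
      C (recA μ (n + 1) * u n) * orthonormalPoly μ (n + 1) -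
      C (recA μ (n + 1) * u (n + 1)) * orthonormalPoly μ n := by
  induction n with
  | zero =>
    have h1 := congrArg C h0
    simp only [C_mul, C_add, C_sub, orthoSum, Finset.sum_range_one, zero_add] at h1 ⊢
    linear_combination (C (u 0)) * recursion_zero h - orthonormalPoly μ 0 * h1
  | succ n ih =>
    have h1 := congrArg C (hu n)
    rw [orthoSum_succ, mul_add, ih]
    simp only [C_mul, C_add] at h1 ⊢
    linear_combination (C (u (n + 1))) * recursion_succ h n - orthonormalPoly μ (n + 1) * h1

/-- The Christoffel–Darboux kernel `∑_{k < n} p_k(z) p_k`. -/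
noncomputable def kernelPoly (μ : Measure ℝ) (n : ℕ) (z : ℝ) : ℝ[X] :=
  orthoSum μ n fun k => (orthonormalPoly μ k).eval z

/-- The Christoffel–Darboux formula. -/
theorem sub_mul_kernelPoly (h : IsNontrivial μ) (z : ℝ) (n : ℕ) :
    (X - C z) * kernelPoly μ (n + 1) z =
      C (recA μ (n + 1) * (orthonormalPoly μ n).eval z) * orthonormalPoly μ (n + 1) -
      C (recA μ (n + 1) * (orthonormalPoly μ (n + 1)).eval z) * orthonormalPoly μ n := by
  have := sub_mul_orthoSum h z 0 (fun k => (orthonormalPoly μ k).eval z)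
    (by simpa using congrArg (eval z) (recursion_zero h))
    (fun n => by simpa using congrArg (eval z) (recursion_succ h n)) n
  simpa [kernelPoly] using this

/-- The values at `z` of the polynomials of the second kind. -/
noncomputable def secondKind (μ : Measure ℝ) (z : ℝ) : ℕ → ℝ
  | 0 => 0
  | 1 => 1
  | n + 2 => ((z - recB μ (n + 2)) * secondKind μ z (n + 1) - recA μ (n + 1) * secondKind μ z n) /
      recA μ (n + 2)

/-- The initial values `0, 1` violate the first recursion relation by exactly `a_1`. The resulting
term `a_1 p_0` is a constant, so the gap estimate can absorb it. -/
theorem sub_mul_orthoSum_secondKind (h : IsNontrivial μ) (z : ℝ) (n : ℕ) :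
    (X - C z) * orthoSum μ (n + 1) (secondKind μ z) = C (recA μ 1) * orthonormalPoly μ 0 +
      C (recA μ (n + 1) * secondKind μ z n) * orthonormalPoly μ (n + 1) -
      C (recA μ (n + 1) * secondKind μ z (n + 1)) * orthonormalPoly μ n := by
  refine sub_mul_orthoSum h z _ _ (by simp [secondKind]) (fun n => ?_) n
  have := (recA_pos h (n + 1)).ne'
  rw [secondKind]
  field_simp
  ring

end Recursion

/-! ### The spectral gap at an isolated point -/

section Gap

variable {μ : Measure ℝ}

theorem IsNontrivial.isFiniteMeasure (h : IsNontrivial μ) : IsFiniteMeasure μ := by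
  have h1 := h.moments 0
  simp only [pow_zero] at h1
  exact ((integrable_const_iff (c := (1 : ℝ))).1 h1).resolve_left one_ne_zero

theorem IsNontrivial.integral_eval_eq (h : IsNontrivial μ) (x₀ : ℝ) (f : ℝ[X]) :
    ∫ x, f.eval x ∂μ = μ.real {x₀} * f.eval x₀ + ∫ x in {x₀}ᶜ, f.eval x ∂μ := by
  rw [← integral_add_compl (measurableSet_singleton x₀) (h.integrable_eval f), integral_singleton,
    smul_eq_mul]

theorem pairing_eq_integral_eval (μ : Measure ℝ) (f g : ℝ[X]) :
    pairing μ f g = ∫ x, (f * g).eval x ∂μ := by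
  simp [pairing]

/-- A small interval around `x₀` has positive mass, and `μ` vanishes off its support, so all of that
mass sits at `x₀`. -/
theorem IsIsolatedPoint.measureReal_singleton_pos [IsFiniteMeasure μ] {x₀ : ℝ}
    (hx : IsIsolatedPoint μ.support x₀) : 0 < μ.real {x₀} := by
  obtain ⟨ε, hε, hS⟩ := hx
  have hmem : x₀ ∈ μ.support := ((Set.ext_iff.1 hS x₀).2 rfl).1
  have hpos : 0 < μ (Set.Ioo (x₀ - ε) (x₀ + ε)) :=
    (Measure.mem_support_iff_forall x₀).1 hmem _ (Ioo_mem_nhds (by linarith) (by linarith))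
  have hle : μ (Set.Ioo (x₀ - ε) (x₀ + ε)) ≤ μ {x₀} := by
    refine measure_mono_ae ?_
    filter_upwards [Measure.support_mem_ae (μ := μ)] with x hx hxI
    exact (Set.ext_iff.1 hS x).1 ⟨hx, hxI⟩
  exact ENNReal.toReal_pos (hpos.trans_le hle).ne' (measure_ne_top _ _)

theorem IsIsolatedPoint.exists_ae_restrict_le {x₀ : ℝ} (hx : IsIsolatedPoint μ.support x₀) :
    ∃ ε > 0, ∀ᵐ x ∂μ.restrict {x₀}ᶜ, ε ^ 2 ≤ (x - x₀) ^ 2 := by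
  obtain ⟨ε, hε, hS⟩ := hx
  refine ⟨ε, hε, ?_⟩
  rw [ae_restrict_iff' (measurableSet_singleton x₀).compl]
  filter_upwards [Measure.support_mem_ae (μ := μ)] with x hx hne
  by_contra! hlt
  obtain ⟨h1, h2⟩ := abs_lt.1 (abs_lt_of_sq_lt_sq hlt hε.le)
  exact hne ((Set.ext_iff.1 hS x).1 ⟨hx, by linarith, by linarith⟩)

/-- At an isolated point `x₀` of the support, the compression of `x - x₀` to the orthogonal
complement of the constants is bounded below. -/
theorem IsNontrivial.exists_gap (h : IsNontrivial μ) {x₀ : ℝ}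
    (hx : IsIsolatedPoint μ.support x₀) :
    ∃ d > 0, ∀ (f : ℝ[X]) (c : ℝ), pairing μ f 1 = 0 →
      d ^ 2 * pairing μ f f ≤ pairing μ ((X - C x₀) * f - C c) ((X - C x₀) * f - C c) := by
  have := h.isFiniteMeasure
  have hm := hx.measureReal_singleton_pos
  obtain ⟨ε, hε, hgap⟩ := hx.exists_ae_restrict_le
  set m := μ.real {x₀}
  set ν := μ.restrict {x₀}ᶜ with hν
  set M := μ.real Set.univ
  have hM : 0 ≤ M := measureReal_nonneg
  have hνM : ν.real Set.univ ≤ M :=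
    ENNReal.toReal_mono (measure_ne_top _ _) (Measure.restrict_le_self _)
  have hint : ∀ f : ℝ[X], Integrable (fun x => f.eval x) ν := fun f =>
    (h.integrable_eval f).restrict
  -- One factor `1 + M / m` comes from recovering `f(x₀)` from the values of `f` off `x₀`. The other
  -- comes from absorbing `c`, whose square is charged to the atom because `g(x₀) = -c`. The `√2`
  -- comes from `(g + c)² ≤ 2g² + 2c²`.
  refine ⟨ε / (√2 * (1 + M / m)), by positivity, fun f c hf => ?_⟩
  set g := (X - C x₀) * f - C c with hg
  have hfμ : pairing μ f f = m * f.eval x₀ ^ 2 + ∫ x, f.eval x ^ 2 ∂ν := by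
    rw [pairing_eq_integral_eval μ, h.integral_eval_eq x₀]
    simp only [eval_mul, pow_two, hν, m]
  have hgμ : pairing μ g g = m * c ^ 2 + ∫ x, g.eval x ^ 2 ∂ν := by
    rw [pairing_eq_integral_eval μ, h.integral_eval_eq x₀]
    simp only [eval_mul, pow_two, hν, m]
    congr 2
    simp [hg]
  have hf0 : m * f.eval x₀ + ∫ x, f.eval x ∂ν = 0 := by
    rw [pairing_eq_integral_eval μ, h.integral_eval_eq x₀] at hf
    simpa using hf
  set F := ∫ x, f.eval x ^ 2 ∂ν
  set G := ∫ x, g.eval x ^ 2 ∂ν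
  have hF : 0 ≤ F := integral_nonneg fun x => sq_nonneg _
  have hG : 0 ≤ G := integral_nonneg fun x => sq_nonneg _
  have hfi : Integrable (fun x => f.eval x ^ 2) ν :=
    (hint (f ^ 2)).congr (ae_of_all _ fun x => eval_pow 2)
  have hgi : Integrable (fun x => g.eval x ^ 2) ν :=
    (hint (g ^ 2)).congr (ae_of_all _ fun x => eval_pow 2)
  have h1 : ε ^ 2 * F ≤ 2 * G + 2 * c ^ 2 * M := by
    calc ε ^ 2 * F = ∫ x, ε ^ 2 * f.eval x ^ 2 ∂ν := (integral_const_mul _ _).symm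
      _ ≤ ∫ x, (2 * g.eval x ^ 2 + 2 * c ^ 2) ∂ν := by
        refine integral_mono_ae (hfi.const_mul _) ((hgi.const_mul _).add (integrable_const _)) ?_
        filter_upwards [hgap] with x hx
        have h2 : (x - x₀) * f.eval x = g.eval x + c := by simp [hg]
        calc ε ^ 2 * f.eval x ^ 2 ≤ (x - x₀) ^ 2 * f.eval x ^ 2 := by gcongr
          _ = (g.eval x + c) ^ 2 := by rw [← h2]; ring
          _ ≤ 2 * g.eval x ^ 2 + 2 * c ^ 2 := by nlinarith [sq_nonneg (g.eval x - c)]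
      _ = 2 * G + 2 * c ^ 2 * ν.real Set.univ := by
        rw [integral_add (hgi.const_mul _) (integrable_const _), integral_const_mul,
          integral_const, smul_eq_mul, mul_comm (ν.real _)]
      _ ≤ 2 * G + 2 * c ^ 2 * M := by gcongr
  have h2 : m * f.eval x₀ ^ 2 ≤ M / m * F := by
    have h3 : (∫ x, f.eval x ∂ν) ^ 2 ≤ ν.real Set.univ * F := by
      set I := ∫ x, f.eval x ∂ν
      set N := ν.real Set.univ
      -- Cauchy–Schwarz against the constant `1`: the quadratic `∫ (f - t)² dν` in `t` is
      -- nonnegative, so its discriminant is not positive.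
      have h4 : ∀ t : ℝ, 0 ≤ N * (t * t) + (-2 * I) * t + F := fun t => by
        have : 0 ≤ ∫ x, (f.eval x - t) ^ 2 ∂ν := integral_nonneg fun x => sq_nonneg _
        have e : ∫ x, (f.eval x - t) ^ 2 ∂ν = F - 2 * t * I + N * t ^ 2 := by
          have : (fun x => (f.eval x - t) ^ 2) =
              fun x => f.eval x ^ 2 - 2 * t * f.eval x + t ^ 2 := by funext x; ring
          have hd : Integrable (fun x => f.eval x ^ 2 - 2 * t * f.eval x) ν :=
            hfi.sub ((hint f).const_mul _)
          rw [this, integral_add hd (integrable_const _),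
            integral_sub hfi ((hint f).const_mul _), integral_const_mul, integral_const,
            smul_eq_mul]
        linarith
      have := discrim_le_zero h4
      rw [discrim] at this
      nlinarith
    have h5 : m ^ 2 * f.eval x₀ ^ 2 ≤ M * F := by
      rw [eq_neg_of_add_eq_zero_right hf0] at h3
      nlinarith [mul_le_mul_of_nonneg_right hνM hF]
    rw [div_mul_eq_mul_div, le_div_iff₀ hm]
    linarith
  have h6 : ε ^ 2 * F ≤ 2 * (1 + M / m) * pairing μ g g := by
    have h7 : M / m * (m * c ^ 2) = c ^ 2 * M := by field_simp
    have h8 : 0 ≤ M / m * G := by positivity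
    have h9 : 0 ≤ m * c ^ 2 := by positivity
    rw [hgμ]
    linarith
  have h10 : pairing μ f f ≤ (1 + M / m) * F := by rw [hfμ]; linarith
  have hpos : 0 < 1 + M / m := by positivity
  rw [div_pow, mul_pow, Real.sq_sqrt (by norm_num), div_mul_eq_mul_div, div_le_iff₀ (by positivity)]
  calc ε ^ 2 * pairing μ f f ≤ (1 + M / m) * (ε ^ 2 * F) := by
        linarith [mul_le_mul_of_nonneg_left h10 (sq_nonneg ε)]
    _ ≤ (1 + M / m) * (2 * (1 + M / m) * pairing μ g g) := by gcongr
    _ = pairing μ g g * (2 * (1 + M / m) ^ 2) := by ring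

end Gap

/-! ### Two zeros near the isolated point -/

section TwoZeros

variable {μ : Measure ℝ}

theorem IsNontrivial.pairing_kernelPoly_self_pos (h : IsNontrivial μ) (n : ℕ) (z : ℝ) :
    0 < pairing μ (kernelPoly μ (n + 1) z) (kernelPoly μ (n + 1) z) := by
  obtain ⟨c, hc, h0⟩ := orthonormalPoly_zero_eq_C h
  rw [kernelPoly, h.pairing_orthoSum]
  refine Finset.sum_pos' (fun k _ => mul_self_nonneg _) ⟨0, by simp, ?_⟩
  rw [h0, eval_C]
  positivity

/-- Two distinct zeros of `p_n` near `x₀` force the second kind solution to be small at `n`. -/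
theorem IsNontrivial.secondKind_sq_le (h : IsNontrivial μ) {x₀ d δ : ℝ} (hδ : 0 ≤ δ) (hδd : δ < d)
    (hd : ∀ (f : ℝ[X]) (c : ℝ), pairing μ f 1 = 0 →
      d ^ 2 * pairing μ f f ≤ pairing μ ((X - C x₀) * f - C c) ((X - C x₀) * f - C c))
    (n : ℕ) {z₁ z₂ : ℝ} (hne : z₁ ≠ z₂) (hz₁ : (z₁ - x₀) ^ 2 ≤ δ ^ 2) (hz₂ : (z₂ - x₀) ^ 2 ≤ δ ^ 2)
    (h₁ : (orthonormalPoly μ n).eval z₁ = 0) (h₂ : (orthonormalPoly μ n).eval z₂ = 0) :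
    secondKind μ x₀ n ^ 2 * (d - δ) ^ 2 ≤
      δ ^ 2 * ∑ k ∈ Finset.range n, secondKind μ x₀ k ^ 2 := by
  obtain ⟨c₀, hc₀, hp₀⟩ := orthonormalPoly_zero_eq_C h
  cases n with
  | zero => simp [hp₀, hc₀.ne'] at h₁
  | succ n =>
    set a := recA μ (n + 1)
    have ha : 0 < a := recA_pos h n
    set P := orthonormalPoly μ (n + 1)
    set v₁ := kernelPoly μ (n + 1) z₁ with hv₁
    set v₂ := kernelPoly μ (n + 1) z₂ with hv₂
    set y₁ := (orthonormalPoly μ n).eval z₁ with hy₁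
    set y₂ := (orthonormalPoly μ n).eval z₂ with hy₂
    have hP : ∀ c, pairing μ (orthoSum μ (n + 1) c) P = 0 := fun c => by
      rw [h.pairing_orthoSum_orthonormalPoly, if_neg (lt_irrefl _)]
    have hPP : pairing μ P P = 1 := by rw [h.pairing_orthonormalPoly, if_pos rfl]
    have hv₁P : pairing μ v₁ P = 0 := hP _
    have hv₂P : pairing μ v₂ P = 0 := hP _
    have e₁ : (X - C z₁) * v₁ = C (a * y₁) * P := by
      have := sub_mul_kernelPoly h z₁ n
      rwa [h₁, mul_zero, C_0, zero_mul, sub_zero] at this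
    have e₂ : (X - C z₂) * v₂ = C (a * y₂) * P := by
      have := sub_mul_kernelPoly h z₂ n
      rwa [h₂, mul_zero, C_0, zero_mul, sub_zero] at this
    -- The kernels at two zeros are eigenvectors of the truncated Jacobi matrix for distinct
    -- eigenvalues.
    have horth : pairing μ v₁ v₂ = 0 := by
      have i₁ : pairing μ ((X - C z₁) * v₁) v₂ = 0 := by
        rw [e₁, pairing_C_mul, pairing_comm, hv₂P, mul_zero]
      have i₂ : pairing μ ((X - C z₂) * v₁) v₂ = 0 := by
        rw [pairing_mul_comm, e₂, pairing_C_mul_right, hv₁P, mul_zero]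
      rw [sub_mul, h.pairing_sub, pairing_C_mul] at i₁ i₂
      have : (z₁ - z₂) * pairing μ v₁ v₂ = 0 := by linarith
      exact (mul_eq_zero.1 this).resolve_left (sub_ne_zero.2 hne)
    have horth' : pairing μ v₂ v₁ = 0 := by rw [pairing_comm, horth]
    set f := v₁ - v₂ with hf
    set s := (z₁ - x₀) with hs
    set t := (z₂ - x₀) with ht
    set g := C s * v₁ - C t * v₂ with hg
    set β := a * (y₁ - y₂) with hβ
    have hXf : (X - C x₀) * f = g + C β * P := by
      simp only [hf, hg, hβ, hs, ht, C_mul, C_sub] at e₁ e₂ ⊢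
      linear_combination e₁ - e₂
    have hff : pairing μ f f = pairing μ v₁ v₁ + pairing μ v₂ v₂ := by
      simp only [hf, h.pairing_sub, h.pairing_sub_right, horth, horth']
      ring
    have hgg : pairing μ g g = s ^ 2 * pairing μ v₁ v₁ + t ^ 2 * pairing μ v₂ v₂ := by
      simp only [hg, h.pairing_sub, h.pairing_sub_right, pairing_C_mul, pairing_C_mul_right,
        horth, horth']
      ring
    have hgP : pairing μ g P = 0 := by
      simp [hg, h.pairing_sub, pairing_C_mul, hv₁P, hv₂P]
    have hgf : pairing μ g g ≤ δ ^ 2 * pairing μ f f := by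
      rw [hgg, hff, mul_add]
      gcongr <;> exact pairing_nonneg _ _
    have hfpos : 0 < pairing μ f f := by
      rw [hff]
      exact add_pos (h.pairing_kernelPoly_self_pos n z₁) (h.pairing_kernelPoly_self_pos n z₂)
    have hfp : ∀ j, j < n + 1 → pairing μ f (orthonormalPoly μ j) =
        (orthonormalPoly μ j).eval z₁ - (orthonormalPoly μ j).eval z₂ := fun j hj => by
      simp only [hf, hv₁, hv₂, kernelPoly, h.pairing_sub, h.pairing_orthoSum_orthonormalPoly,
        if_pos hj]
    -- Both kernels have the same `p_0` coefficient, since `p_0` is constant; this is why their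
    -- difference is taken.
    have hf0 : pairing μ f (orthonormalPoly μ 0) = 0 := by
      rw [hfp 0 n.succ_pos, hp₀]
      simp
    have hf1 : pairing μ f 1 = 0 := by
      have h3 := hf0
      rw [hp₀, ← mul_one (C c₀), pairing_C_mul_right] at h3
      exact (mul_eq_zero.1 h3).resolve_left hc₀.ne'
    have hdβ : d ^ 2 * pairing μ f f ≤ δ ^ 2 * pairing μ f f + β ^ 2 := by
      have h3 := hd f 0 hf1
      rw [C_0, sub_zero, hXf] at h3
      simp only [h.pairing_add, h.pairing_add_right, pairing_C_mul, pairing_C_mul_right, hPP,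
        pairing_comm μ P g, hgP] at h3
      linarith
    set r := secondKind μ x₀ (n + 1)
    set w := orthoSum μ (n + 1) (secondKind μ x₀) with hw
    have hww : pairing μ w w = ∑ k ∈ Finset.range (n + 1), secondKind μ x₀ k ^ 2 := by
      simp only [hw, h.pairing_orthoSum, pow_two]
    -- Moving `x - x₀` across the pairing of `w` and `f` kills every boundary term except the one at
    -- `p_n`, where `f` has coefficient `y₁ - y₂`.
    have hrβ : pairing μ w g = -(r * β) := by
      have h3 : pairing μ ((X - C x₀) * w) f = pairing μ w ((X - C x₀) * f) :=
        pairing_mul_comm _ _ _ _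
      rw [sub_mul_orthoSum_secondKind h, hXf, h.pairing_add_right, pairing_C_mul_right, hP,
        pairing_comm, h.pairing_sub_right, h.pairing_add_right] at h3
      have h4 : pairing μ f (orthonormalPoly μ (n + 1)) = 0 := by
        rw [hf, h.pairing_sub, hv₁P, hv₂P, sub_zero]
      simp only [pairing_C_mul_right, hf0, h4, hfp n n.lt_succ_self] at h3
      rw [hβ]
      linarith
    have hcs : r ^ 2 * β ^ 2 ≤ pairing μ w w * (δ ^ 2 * pairing μ f f) :=
      calc r ^ 2 * β ^ 2 = pairing μ w g ^ 2 := by rw [hrβ]; ring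
        _ ≤ pairing μ w w * pairing μ g g := h.pairing_sq_le _ _
        _ ≤ _ := by gcongr; exact pairing_nonneg _ _
    rw [← hww]
    -- Here `(d - δ)² ≤ d² - δ²`, because `0 ≤ δ ≤ d`.
    have h5 : (d - δ) ^ 2 * pairing μ f f ≤ β ^ 2 := by
      nlinarith [mul_nonneg (mul_nonneg hδ (sub_nonneg.2 hδd.le)) hfpos.le]
    have h6 : pairing μ f f * (r ^ 2 * (d - δ) ^ 2) ≤
        pairing μ f f * (δ ^ 2 * pairing μ w w) := by
      nlinarith [mul_le_mul_of_nonneg_left h5 (sq_nonneg r)]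
    exact le_of_mul_le_mul_left h6 hfpos

theorem exists_pair_of_one_lt_zeroCount {n : ℕ} {x₀ δ : ℝ} (hn : 1 < zeroCount μ n x₀ δ) :
    ∃ z₁ z₂, z₁ ≠ z₂ ∧ |z₁ - x₀| < δ ∧ |z₂ - x₀| < δ ∧
      (orthonormalPoly μ n).eval z₁ = 0 ∧ (orthonormalPoly μ n).eval z₂ = 0 := by
  obtain ⟨z₁, z₂, ⟨⟨a₁, b₁⟩, c₁⟩, ⟨⟨a₂, b₂⟩, c₂⟩, hne⟩ := Set.one_lt_encard_iff.1 hn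
  exact ⟨z₁, z₂, hne, abs_lt.2 ⟨by linarith, by linarith⟩, abs_lt.2 ⟨by linarith, by linarith⟩,
    c₁, c₂⟩

/-- Two zeros of both polynomials would make two consecutive values of `secondKind` small, while the
gap applied to their orthonormal sum forbids this. -/
theorem IsNontrivial.zeroCount_le_one_or (h : IsNontrivial μ) {x₀ d : ℝ} (hd0 : 0 < d)
    (hd : ∀ (f : ℝ[X]) (c : ℝ), pairing μ f 1 = 0 →
      d ^ 2 * pairing μ f f ≤ pairing μ ((X - C x₀) * f - C c) ((X - C x₀) * f - C c))
    (n : ℕ) :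
    zeroCount μ n x₀ (d ^ 2 / (d + √2 * recA μ (n + 1))) ≤ 1 ∨
      zeroCount μ (n + 1) x₀ (d ^ 2 / (d + √2 * recA μ (n + 1))) ≤ 1 := by
  by_contra! hcon
  obtain ⟨c₀, hc₀, hp₀⟩ := orthonormalPoly_zero_eq_C h
  obtain ⟨z₁, z₂, hz, hz₁, hz₂, e₁, e₂⟩ := exists_pair_of_one_lt_zeroCount hcon.1
  obtain ⟨y₁, y₂, hy, hy₁, hy₂, i₁, i₂⟩ := exists_pair_of_one_lt_zeroCount hcon.2
  cases n with
  | zero => simp [hp₀, hc₀.ne'] at e₁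
  | succ n =>
    set a := recA μ (n + 1 + 1)
    have ha : 0 < a := recA_pos h (n + 1)
    set D := d ^ 2 / (d + √2 * a)
    -- The largest of the four distances is strictly below `D`; this strictness yields the
    -- contradiction at the end.
    set δ := max (max |z₁ - x₀| |z₂ - x₀|) (max |y₁ - x₀| |y₂ - x₀|)
    have hδ0 : 0 ≤ δ := (abs_nonneg _).trans ((le_max_left _ _).trans (le_max_left _ _))
    have hδD : δ < D := max_lt (max_lt hz₁ hz₂) (max_lt hy₁ hy₂)
    have hmul : δ * (d + √2 * a) < d ^ 2 := (lt_div_iff₀ (by positivity)).1 hδD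
    have hδd : δ < d := by
      have : 0 ≤ δ * (√2 * a) := by positivity
      nlinarith
    have hsq : ∀ z, |z - x₀| ≤ δ → (z - x₀) ^ 2 ≤ δ ^ 2 := fun z hz => by
      rw [← sq_abs]; gcongr
    have k₁ := h.secondKind_sq_le hδ0 hδd hd (n + 1) hz
      (hsq _ ((le_max_left _ _).trans (le_max_left _ _)))
      (hsq _ ((le_max_right _ _).trans (le_max_left _ _))) e₁ e₂
    have k₂ := h.secondKind_sq_le hδ0 hδd hd (n + 1 + 1) hy
      (hsq _ ((le_max_left _ _).trans (le_max_right _ _)))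
      (hsq _ ((le_max_right _ _).trans (le_max_right _ _))) i₁ i₂
    set r := secondKind μ x₀
    set w := orthoSum μ (n + 1 + 1) r with hw
    have hww : pairing μ w w = ∑ k ∈ Finset.range (n + 1 + 1), r k ^ 2 := by
      simp only [hw, h.pairing_orthoSum, pow_two]
    have hW : ∑ k ∈ Finset.range (n + 1), r k ^ 2 ≤ pairing μ w w := by
      rw [hww, Finset.sum_range_succ _ (n + 1)]
      linarith [sq_nonneg (r (n + 1))]
    rw [← hww] at k₂
    have k₁' := k₁.trans (mul_le_mul_of_nonneg_left hW (sq_nonneg δ))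
    have hWpos : 0 < pairing μ w w := by
      rw [hww]
      refine Finset.sum_pos' (fun k _ => sq_nonneg _) ⟨1, by simp, ?_⟩
      simp [r, secondKind]
    -- The `p_0` coefficient of `w` is `r 0 = 0`.
    have hw1 : pairing μ w 1 = 0 := by
      have h3 := h.pairing_orthoSum_orthonormalPoly (n + 1 + 1) r 0
      rw [if_pos (by positivity), hp₀, ← mul_one (C c₀), pairing_C_mul_right] at h3
      exact (mul_eq_zero.1 (h3.trans rfl)).resolve_left hc₀.ne'
    -- The constant `recA μ 1 * c₀` is the term `a_1 p_0` of `(x - x₀) w`.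
    have hdw : d ^ 2 * pairing μ w w ≤ a ^ 2 * (r (n + 1) ^ 2 + r (n + 1 + 1) ^ 2) := by
      refine (hd w (recA μ 1 * c₀) hw1).trans_eq ?_
      have : (X - C x₀) * w - C (recA μ 1 * c₀) =
          C (a * r (n + 1)) * orthonormalPoly μ (n + 1 + 1) -
          C (a * r (n + 1 + 1)) * orthonormalPoly μ (n + 1) := by
        have key : (X - C x₀) * w = C (recA μ 1) * C c₀ +
            C (a * r (n + 1)) * orthonormalPoly μ (n + 1 + 1) -
            C (a * r (n + 1 + 1)) * orthonormalPoly μ (n + 1) := by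
          rw [← hp₀]
          exact sub_mul_orthoSum_secondKind h x₀ (n + 1)
        rw [key, ← C_mul]
        abel
      rw [this]
      simp only [h.pairing_sub, h.pairing_sub_right, pairing_C_mul, pairing_C_mul_right,
        h.pairing_orthonormalPoly]
      simp
      ring
    have hfin : (d * (d - δ)) ^ 2 ≤ (√2 * a * δ) ^ 2 := by
      refine le_of_mul_le_mul_right ?_ hWpos
      calc (d * (d - δ)) ^ 2 * pairing μ w w = (d - δ) ^ 2 * (d ^ 2 * pairing μ w w) := by ring
        _ ≤ (d - δ) ^ 2 * (a ^ 2 * (r (n + 1) ^ 2 + r (n + 1 + 1) ^ 2)) := by gcongr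
        _ = a ^ 2 * (r (n + 1) ^ 2 * (d - δ) ^ 2 + r (n + 1 + 1) ^ 2 * (d - δ) ^ 2) := by ring
        _ ≤ a ^ 2 * (δ ^ 2 * pairing μ w w + δ ^ 2 * pairing μ w w) := by gcongr
        _ = (√2 * a * δ) ^ 2 * pairing μ w w := by
          rw [mul_pow, mul_pow, Real.sq_sqrt (by norm_num)]; ring
    have := abs_le_of_sq_le_sq' hfin (by positivity)
    nlinarith [this.2]

end TwoZeros

/-! ### Existence of a zero near an atom -/

section ExistsZero

variable {μ : Measure ℝ}

/-- The polynomial `∑ i, u_i p_i` as a linear function of the coefficients. -/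
noncomputable def polyOfCoeffs (μ : Measure ℝ) (n : ℕ) : EuclideanSpace ℝ (Fin n) →ₗ[ℝ] ℝ[X] where
  toFun u := ∑ i, C (u i) * orthonormalPoly μ i
  map_add' u v := by simp [add_mul, Finset.sum_add_distrib]
  map_smul' c u := by simp [Finset.mul_sum, smul_eq_C_mul, mul_assoc]

theorem polyOfCoeffs_apply (n : ℕ) (u : EuclideanSpace ℝ (Fin n)) :
    polyOfCoeffs μ n u = ∑ i, C (u i) * orthonormalPoly μ i := rfl

theorem IsNontrivial.pairing_polyOfCoeffs (h : IsNontrivial μ) (n : ℕ) (f : ℝ[X])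
    (u : EuclideanSpace ℝ (Fin n)) :
    pairing μ f (polyOfCoeffs μ n u) = ∑ i, u i * pairing μ f (orthonormalPoly μ i) := by
  rw [pairing_comm, polyOfCoeffs_apply, h.pairing_sum]
  simp [pairing_C_mul, pairing_comm μ f]

theorem IsNontrivial.degree_polyOfCoeffs_lt (h : IsNontrivial μ) (n : ℕ)
    (u : EuclideanSpace ℝ (Fin n)) : (polyOfCoeffs μ n u).degree < n := by
  rw [← mem_degreeLT, polyOfCoeffs_apply]
  refine Submodule.sum_mem _ fun i _ => ?_
  rw [← smul_eq_C_mul]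
  refine Submodule.smul_mem _ _ ?_
  rw [mem_degreeLT, (orthonormalPoly_spec h).degree]
  exact_mod_cast i.2

/-- The truncated Jacobi matrix: the compression of multiplication by `x` to the polynomials of
degree less than `n`, in the basis `p_0, …, p_{n-1}`. -/
noncomputable def jacobi (h : IsNontrivial μ) (n : ℕ) :
    EuclideanSpace ℝ (Fin n) →ₗ[ℝ] EuclideanSpace ℝ (Fin n) where
  toFun u := WithLp.toLp 2 fun i => pairing μ (X * polyOfCoeffs μ n u) (orthonormalPoly μ i)
  map_add' u v := by
    ext i
    simp [mul_add, h.pairing_add]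
  map_smul' c u := by
    ext i
    simp [smul_eq_C_mul, mul_left_comm X, pairing_C_mul]

theorem jacobi_apply (h : IsNontrivial μ) (n : ℕ) (u : EuclideanSpace ℝ (Fin n)) (i : Fin n) :
    jacobi h n u i = pairing μ (X * polyOfCoeffs μ n u) (orthonormalPoly μ i) := rfl

theorem jacobi_isSymmetric (h : IsNontrivial μ) (n : ℕ) : (jacobi h n).IsSymmetric := by
  have key : ∀ u v, inner ℝ (jacobi h n u) v =
      pairing μ (X * polyOfCoeffs μ n u) (polyOfCoeffs μ n v) := fun u v => by
    simp [PiLp.inner_apply, h.pairing_polyOfCoeffs, jacobi_apply]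
  intro u v
  rw [key, pairing_X_mul_comm, ← key, real_inner_comm]

theorem IsNontrivial.pairing_polyOfCoeffs_orthonormalPoly (h : IsNontrivial μ) (n : ℕ)
    (u : EuclideanSpace ℝ (Fin n)) (i : Fin n) :
    pairing μ (polyOfCoeffs μ n u) (orthonormalPoly μ i) = u i := by
  rw [pairing_comm, h.pairing_polyOfCoeffs]
  simp [h.pairing_orthonormalPoly, Fin.val_inj]

/-- An eigenvector gives a polynomial `f` of degree below `n` with `(x - l) f` orthogonal to `p_0,
…, p_{n-1}`. Having degree at most `n`, this product is a nonzero multiple of `p_n`, and it vanishes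
at `l`. -/
theorem eval_eq_zero_of_hasEigenvalue_jacobi (h : IsNontrivial μ) {n : ℕ} {l : ℝ}
    (hl : Module.End.HasEigenvalue (jacobi h n) l) : (orthonormalPoly μ n).eval l = 0 := by
  obtain ⟨v, hv⟩ := hl.exists_hasEigenvector
  set f := polyOfCoeffs μ n v with hf
  have hf0 : f ≠ 0 := fun h0 => hv.2 (by
    ext i
    rw [← h.pairing_polyOfCoeffs_orthonormalPoly n v i, ← hf, h0]
    simp [pairing])
  have hdeg : ((X - C l) * f).degree < ((n + 1 : ℕ) : WithBot ℕ) := by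
    have h1 := h.degree_polyOfCoeffs_lt n v
    rw [← hf, degree_eq_natDegree hf0] at h1
    rw [degree_mul, degree_X_sub_C, degree_eq_natDegree hf0]
    have h2 : f.natDegree < n := by exact_mod_cast h1
    exact_mod_cast (by lia : 1 + f.natDegree < n + 1)
  have hexp := (orthonormalPoly_spec h).expand h (n + 1) _ hdeg
  rw [Finset.sum_range_succ, Finset.sum_eq_zero, zero_add] at hexp
  · have h3 := congrArg (eval l) hexp
    simp only [eval_mul, eval_sub, eval_X, eval_C, sub_self, zero_mul] at h3
    refine (mul_eq_zero.1 h3.symm).resolve_left fun h4 => ?_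
    rw [h4, C_0, zero_mul] at hexp
    exact (mul_ne_zero (X_sub_C_ne_zero l) hf0) hexp
  · intro k hk
    have h5 := congrArg (fun u : EuclideanSpace ℝ (Fin n) => u ⟨k, Finset.mem_range.1 hk⟩)
      hv.apply_eq_smul
    simp only [jacobi_apply, PiLp.smul_apply, smul_eq_mul] at h5
    rw [sub_mul, h.pairing_sub, pairing_C_mul, ← hf] at *
    have h6 := h.pairing_polyOfCoeffs_orthonormalPoly n v ⟨k, Finset.mem_range.1 hk⟩
    simp only at h6 h5
    rw [hf, h5, h6, sub_self, C_0, zero_mul]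

/-- `p_{n+1}` has a zero within `a_{n+1} |p_{n+1}(x₀)| / (∑_{k ≤ n} p_k(x₀)²)^{1/2}` of `x₀`. -/
theorem IsNontrivial.exists_zero_near (h : IsNontrivial μ) (x₀ : ℝ) (n : ℕ) :
    ∃ l, (orthonormalPoly μ (n + 1)).eval l = 0 ∧
      (l - x₀) ^ 2 * ∑ k ∈ Finset.range (n + 1), (orthonormalPoly μ k).eval x₀ ^ 2 ≤
        (recA μ (n + 1) * (orthonormalPoly μ (n + 1)).eval x₀) ^ 2 := by
  obtain ⟨c₀, hc₀, hp₀⟩ := orthonormalPoly_zero_eq_C h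
  set u : EuclideanSpace ℝ (Fin (n + 1)) :=
    WithLp.toLp 2 fun i => (orthonormalPoly μ i).eval x₀ with hu
  have hu0 : u ≠ 0 := fun h0 => by
    have := congrArg (fun v : EuclideanSpace ℝ (Fin (n + 1)) => v 0) h0
    simp [hu, hp₀, hc₀.ne'] at this
  have hnorm : ‖u‖ ^ 2 = ∑ k ∈ Finset.range (n + 1), (orthonormalPoly μ k).eval x₀ ^ 2 := by
    rw [EuclideanSpace.norm_sq_eq, Finset.sum_range]
    simp [hu]
  have hpoly : polyOfCoeffs μ (n + 1) u = kernelPoly μ (n + 1) x₀ := by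
    rw [polyOfCoeffs_apply, kernelPoly, orthoSum, Finset.sum_range]
  -- By Christoffel–Darboux, `u` satisfies the eigenvalue equation at `x₀` except in the last
  -- coordinate.
  have happ : ∀ i : Fin (n + 1), (jacobi h (n + 1) u - x₀ • u) i =
      if (i : ℕ) = n then -(recA μ (n + 1) * (orthonormalPoly μ (n + 1)).eval x₀) else 0 := by
    intro i
    rw [PiLp.sub_apply, PiLp.smul_apply, smul_eq_mul, jacobi_apply,
      ← h.pairing_polyOfCoeffs_orthonormalPoly (n + 1) u i, ← pairing_C_mul, ← h.pairing_sub,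
      ← sub_mul, hpoly, sub_mul_kernelPoly h, h.pairing_sub, pairing_C_mul, pairing_C_mul,
      h.pairing_orthonormalPoly, h.pairing_orthonormalPoly, if_neg i.2.ne']
    split_ifs with h1 h2 h2
    · ring
    · exact absurd h1.symm h2
    · exact absurd h2.symm h1
    · ring
  obtain ⟨l, hl, hle⟩ := (jacobi_isSymmetric h (n + 1)).exists_eigenvalue_sq_mul_le x₀ hu0
  refine ⟨l, eval_eq_zero_of_hasEigenvalue_jacobi h hl, ?_⟩
  rw [← hnorm]
  refine hle.trans_eq ?_
  rw [EuclideanSpace.norm_sq_eq, Finset.sum_eq_single (Fin.last n)]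
  · rw [happ, if_pos (Fin.val_last n), norm_neg, Real.norm_eq_abs, sq_abs]
  · intro i _ hi
    rw [happ, if_neg (fun h1 : (i : ℕ) = n => hi (Fin.ext h1))]
    simp
  · simp

/-- If `x₀` carries positive mass, then `∑ p_k(x₀)²` converges. -/
theorem IsNontrivial.summable_eval_sq (h : IsNontrivial μ) {x₀ : ℝ} (hx : 0 < μ.real {x₀}) :
    Summable fun k => (orthonormalPoly μ k).eval x₀ ^ 2 := by
  refine summable_of_sum_range_le (c := (μ.real {x₀})⁻¹) (fun k => sq_nonneg _) fun n => ?_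
  set S := ∑ k ∈ Finset.range n, (orthonormalPoly μ k).eval x₀ ^ 2 with hS
  have hS0 : 0 ≤ S := Finset.sum_nonneg fun _ _ => sq_nonneg _
  set K := kernelPoly μ n x₀ with hK
  have h1 : pairing μ K K = S := by
    rw [hK, kernelPoly, h.pairing_orthoSum, hS]
    simp only [pow_two]
  have h2 : K.eval x₀ = S := by
    simp [hK, kernelPoly, orthoSum, eval_finsetSum, hS, pow_two]
  -- The atom's share of `‖K‖²` is `μ{x₀} K(x₀)²`, and the kernel satisfies `K(x₀) = ‖K‖² = S`;
  -- hence `S ≤ 1 / μ{x₀}`.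
  have h3 : μ.real {x₀} * S ^ 2 ≤ S := by
    conv_rhs => rw [← h1, pairing_eq_integral_eval μ, h.integral_eval_eq x₀]
    have : 0 ≤ ∫ x in {x₀}ᶜ, (K * K).eval x ∂μ :=
      integral_nonneg fun x => by simpa using mul_self_nonneg _
    rw [eval_mul, h2]
    linarith
  rw [← one_div, le_div_iff₀ hx]
  rcases hS0.eq_or_lt with h4 | h4
  · simp [← h4]
  · nlinarith

/-- In `IsNontrivial.exists_zero_near` the numerator tends to `0` by summability and the bound `A`,
while the sum of squares never drops below its constant first term `p_0²`. -/
theorem IsNontrivial.eventually_one_le_zeroCount (h : IsNontrivial μ) {x₀ : ℝ}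
    (hx : 0 < μ.real {x₀}) {A δ : ℝ} (hA : ∀ n, recA μ (n + 1) ≤ A) (hδ : 0 < δ) :
    ∀ᶠ n in Filter.atTop, 1 ≤ zeroCount μ n x₀ δ := by
  obtain ⟨c₀, hc₀, hp₀⟩ := orthonormalPoly_zero_eq_C h
  have hlim := ((h.summable_eval_sq hx).tendsto_atTop_zero.const_mul (A ^ 2))
  rw [mul_zero] at hlim
  have hev := hlim.eventually (gt_mem_nhds (show 0 < δ ^ 2 * c₀ ^ 2 by positivity))
  filter_upwards [hev, Filter.eventually_ge_atTop 1] with n hn hn1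
  obtain ⟨n, rfl⟩ := Nat.exists_eq_succ_of_ne_zero (by lia : n ≠ 0)
  obtain ⟨l, hl, hle⟩ := h.exists_zero_near x₀ n
  have hS : c₀ ^ 2 ≤ ∑ k ∈ Finset.range (n + 1), (orthonormalPoly μ k).eval x₀ ^ 2 := by
    have := Finset.single_le_sum (f := fun k => (orthonormalPoly μ k).eval x₀ ^ 2)
      (fun k _ => sq_nonneg _) (Finset.mem_range.2 n.succ_pos)
    simpa [hp₀] using this
  have h1 : (l - x₀) ^ 2 * c₀ ^ 2 < δ ^ 2 * c₀ ^ 2 :=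
    calc _ ≤ (l - x₀) ^ 2 * ∑ k ∈ Finset.range (n + 1), (orthonormalPoly μ k).eval x₀ ^ 2 := by
          gcongr
      _ ≤ _ := hle
      _ ≤ A ^ 2 * (orthonormalPoly μ (n + 1)).eval x₀ ^ 2 := by
        rw [mul_pow]
        have := hA n
        have := (recA_pos h n).le
        gcongr
      _ < _ := hn
  obtain ⟨h2, h3⟩ := abs_lt.1 (abs_lt_of_sq_lt_sq (lt_of_mul_lt_mul_right h1 (by positivity)) hδ.le)
  exact Set.one_le_encard_iff_nonempty.2 ⟨l, ⟨by linarith, by linarith⟩, hl⟩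

end ExistsZero

/-! ### Combining the upper and lower bounds -/

theorem zeroCount_mono (μ : Measure ℝ) (n : ℕ) (x₀ : ℝ) {δ δ' : ℝ} (hδ : δ ≤ δ') :
    zeroCount μ n x₀ δ ≤ zeroCount μ n x₀ δ' :=
  Set.encard_le_encard fun _ hx =>
    ⟨Set.Ioo_subset_Ioo (by linarith) (by linarith) hx.1, hx.2⟩

end OPRL

theorem theorem2 (μ : MeasureTheory.Measure ℝ) (hμ : OPRL.IsNontrivial μ)
    (x₀ : ℝ) (hx₀ : OPRL.IsIsolatedPoint μ.support x₀) :
    ∃ d₀ : ℝ, 0 < d₀ ∧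
      (∀ n : ℕ,
        OPRL.zeroCount μ n x₀ (d₀ ^ 2 / (d₀ + √2 * OPRL.recA μ (n + 1))) ≤ 1 ∨
        OPRL.zeroCount μ (n + 1) x₀ (d₀ ^ 2 / (d₀ + √2 * OPRL.recA μ (n + 1))) ≤ 1) ∧
      (∀ aInf : ℝ, IsLUB {a : ℝ | ∃ n : ℕ, 1 ≤ n ∧ a = OPRL.recA μ n} aInf →
        ∀ᶠ n : ℕ in Filter.atTop,
          OPRL.zeroCount μ n x₀ (d₀ ^ 2 / (d₀ + √2 * aInf)) = 1 ∨
          OPRL.zeroCount μ (n + 1) x₀ (d₀ ^ 2 / (d₀ + √2 * aInf)) = 1) := by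
  have := hμ.isFiniteMeasure
  obtain ⟨d, hd0, hd⟩ := hμ.exists_gap hx₀
  have hone := hμ.zeroCount_le_one_or hd0 hd
  refine ⟨d, hd0, hone, fun A hA => ?_⟩
  have hle : ∀ n, OPRL.recA μ (n + 1) ≤ A := fun n => hA.1 ⟨n + 1, by lia, rfl⟩
  have hA0 : 0 < A := (OPRL.recA_pos hμ 0).trans_le (hle 0)
  have hev := hμ.eventually_one_le_zeroCount hx₀.measureReal_singleton_pos hle
    (show 0 < d ^ 2 / (d + √2 * A) by positivity)
  filter_upwards [hev, (Filter.tendsto_add_atTop_nat 1).eventually hev] with n hn hn'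
  have hpos := OPRL.recA_pos hμ n
  -- Since `a_{n+1} ≤ A`, the interval for `A` lies inside the one for `n`, so the upper bound
  -- carries over.
  have hδ : d ^ 2 / (d + √2 * A) ≤ d ^ 2 / (d + √2 * OPRL.recA μ (n + 1)) := by
    have := hle n
    gcongr
  exact (hone n).imp (fun h => le_antisymm ((OPRL.zeroCount_mono μ _ x₀ hδ).trans h) hn)
    fun h => le_antisymm ((OPRL.zeroCount_mono μ _ x₀ hδ).trans h) hn'
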